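/- Let $\Delta$ be a semiregular right-angled building with finite type set $I$, viewed as a chamber system: its Coxeter matrix satisfies $m_{ij}\in\{2,\infty\}$ for all distinct $i,j\in I$, and for each $i\in I$ all $i$-panels have the same (possibly infinite) cardinality $q_i\ge 2$. For each $i\in I$ let $X_i$ be a set of cardinality $q_i$, and let $\lambda=(\lambda_i)_{i\in I}\colon\Delta\to\prod_{i\in I}X_i$ be a legal colouring, i.e. on every $i$-panel $\mathcal P$ the map $\lambda_i|_{\mathcal P}\colon\mathcal P\to X_i$ is a bijection and $\lambda_j|_{\mathcal P}$ is constant for every $j\ne i$. For a type-preserving automorphism $g\in\mathrm{Aut}(\Delta)$ and an $i$-panel $\mathcal P$, the local action of $g$ at $\mathcal P$ is $\sigma_\lambda(g,\mathcal P)=\lambda_i|_{g\mathcal P}\circ g|_{\mathcal P}\circ(\lambda_i|_{\mathcal P})^{-1}\in\mathrm{Sym}(X_i)$. For each $i\in I$ let $F_i\le\mathrm{Sym}(X_i)$ be an arbitrary permutation group (a local group), and let $$\mathcal U(\boldsymbol F)=\{g\in\mathrm{Aut}(\Delta)\mid \sigma_\lambda(g,\mathcal P)\in F_i\text{ for every }i\in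 I\text{ and every }i\text{-panel }\mathcal P\}$$ be the universal group. Every permutation group $G\le\mathrm{Sym}(X)$ carries the permutation topology, in which the pointwise stabilisers in $G$ of the finite subsets of $X$ form a neighbourhood basis of the identity; $\mathrm{Aut}(\Delta)$ and $\mathcal U(\boldsymbol F)$ are regarded as permutation groups of the set of chambers of $\Delta$. A topological group is compactly generated if it is generated by a compact subset. Let $F_i^+$ denote the subgroup of $F_i$ generated by all point stabilisers $(F_i)_x$, $x\in X_i$. Assume that $\mathcal U(\boldsymbol F)$ is closed in $\mathrm{Aut}(\Delta)$, locally compact and compactly generated, and that $F_i^+$ is compactly generated for every $i\in I$. Then the local group $F_i$ is compactly generated for every $i\in I$. -/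

import Mathlib

/-! ### Permutation groups and the permutation topology -/

/-- The permutation topology on `Sym(X)`: the topology of pointwise convergence of maps `X → X`,
with `X` discrete.  A subgroup of `Sym(X)` carries the subspace topology. -/
instance permTopology (X : Type*) : TopologicalSpace (Equiv.Perm X) :=
  TopologicalSpace.induced (fun g : Equiv.Perm X => (g : X → X))
    (@Pi.topologicalSpace X (fun _ => X) (fun _ => ⊥))

theorem permTopology_hasBasis_nhds {X : Type*} (g : Equiv.Perm X) :
    (nhds g).HasBasis (fun _ : Finset X => True)
      (fun Φ => {h : Equiv.Perm X | ∀ x ∈ Φ, h x = g x}) := by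
  let _ : TopologicalSpace X := ⊥
  have : DiscreteTopology X := ⟨rfl⟩
  rw [nhds_induced, nhds_pi]
  simp only [nhds_discrete]
  constructor
  intro t
  simp only [Filter.mem_comap]
  constructor
  · rintro ⟨s, hs, hst⟩
    rw [Filter.mem_pi] at hs
    obtain ⟨J, hJ, u, hu, hus⟩ := hs
    refine ⟨hJ.toFinset, trivial, fun h hh => hst (hus ?_)⟩
    intro x hx
    have h1 := hh x (by simpa using hx)
    have h2 := hu x
    rw [Filter.mem_pure] at h2
    simpa only [h1] using h2
  · rintro ⟨Φ, -, hΦ⟩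
    refine ⟨Set.pi (Φ : Set X) (fun x => {g x}), ?_, ?_⟩
    · exact Filter.pi_mem_pi Φ.finite_toSet (fun x _ => by simp)
    · intro h hh
      exact hΦ (fun x hx => hh x hx)

/-- For a permutation group `G ≤ Sym(X)`, the pointwise stabilisers in `G` of the finite subsets
of `X` form a neighbourhood basis of the identity. -/
theorem permTopology_hasBasis_nhds_one {X : Type*} (G : Subgroup (Equiv.Perm X)) :
    (nhds (1 : G)).HasBasis (fun _ : Finset X => True)
      (fun Φ => {h : G | ∀ x ∈ Φ, (h : Equiv.Perm X) x = x}) := by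
  rw [nhds_subtype]
  exact (permTopology_hasBasis_nhds (1 : Equiv.Perm X)).comap _

/-- `Sym(X)` is a topological group for the permutation topology. -/
instance permTopology_isTopologicalGroup (X : Type*) : IsTopologicalGroup (Equiv.Perm X) where
  continuous_mul := by
    rw [continuous_iff_continuousAt]
    rintro ⟨g, h⟩
    unfold ContinuousAt
    rw [nhds_prod_eq]
    refine ((permTopology_hasBasis_nhds g).prod (permTopology_hasBasis_nhds h)).tendsto_iff
      (permTopology_hasBasis_nhds (g * h)) |>.2 fun Φ _ => ?_
    classical
    refine ⟨(Φ.image h, Φ), ⟨trivial, trivial⟩, ?_⟩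
    rintro ⟨a, b⟩ ⟨ha, hb⟩ x hx
    have h1 : b x = h x := hb x hx
    have h2 : a (h x) = g (h x) := ha (h x) (Finset.mem_image_of_mem h hx)
    simp [Equiv.Perm.mul_apply, h1, h2]
  continuous_inv := by
    rw [continuous_iff_continuousAt]
    intro g
    refine (permTopology_hasBasis_nhds g).tendsto_iff (permTopology_hasBasis_nhds g⁻¹) |>.2
      fun Φ _ => ?_
    classical
    refine ⟨Φ.image (g⁻¹ : Equiv.Perm X), trivial, ?_⟩
    intro a ha x hx
    have h1 : a (g⁻¹ x) = g (g⁻¹ x) := ha (g⁻¹ x) (Finset.mem_image_of_mem _ hx)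
    rw [Equiv.Perm.inv_eq_iff_eq, h1]
    simp

/-- A topological group is compactly generated if it is generated, as an abstract group, by a
compact subset. -/
def IsCompactlyGeneratedGroup (G : Type*) [Group G] [TopologicalSpace G] : Prop :=
  ∃ Q : Set G, IsCompact Q ∧ Subgroup.closure Q = ⊤

/-- `F⁺`: the subgroup of the permutation group `F ≤ Sym(X)` generated by all point stabilisers
in `F`. -/
def plusSubgroup {X : Type*} (F : Subgroup (Equiv.Perm X)) : Subgroup F :=
  Subgroup.closure {f : F | ∃ x : X, (f : Equiv.Perm X) x = x}

/-! ### Chamber systems and buildings -/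

/-- A chamber system over `I` with set of chambers `C`: an equivalence relation, `i`-adjacency,
for each `i ∈ I`. -/
structure ChamberSystem (I : Type*) (C : Type*) where
  adj : I → Setoid C

namespace ChamberSystem

variable {I C : Type*}

/-- The `i`-panel containing the chamber `c`. -/
def panel (Δ : ChamberSystem I C) (i : I) (c : C) : Set C :=
  {d | Δ.adj i c d}

/-- `Δ.Gallery ω c d`: there is a gallery of type `ω` from `c` to `d`.  Consecutive chambers of a
gallery are distinct. -/
inductive Gallery (Δ : ChamberSystem I C) : List I → C → C → Prop
  | nil (c : C) : Gallery Δ [] c c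
  | cons {i : I} {ω : List I} {c d e : C} :
      Δ.adj i c d → c ≠ d → Gallery Δ ω d e → Gallery Δ (i :: ω) c e

/-- `Δ` is a building of type `M`: it is non-empty, each panel contains at least two chambers, and
there is a distance function `δ` with values in the Coxeter group of type `M` such that, for each
reduced word `ω`, `δ c d` is the element represented by `ω` if and only if `c` and `d` are joined
by a gallery of type `ω`. -/
def IsBuilding (Δ : ChamberSystem I C) (M : CoxeterMatrix I) : Prop :=
  Nonempty C ∧
  (∀ (i : I) (c : C), ∃ d ∈ Δ.panel i c, d ≠ c) ∧
  ∃ δ : C → C → M.Group, ∀ (c d : C) (ω : List I), M.toCoxeterSystem.IsReduced ω →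
    (δ c d = M.toCoxeterSystem.wordProd ω ↔ Δ.Gallery ω c d)

/-- The group of type-preserving automorphisms: the permutations of the set of chambers that
preserve `i`-adjacency for all `i`. -/
def Aut (Δ : ChamberSystem I C) : Subgroup (Equiv.Perm C) where
  carrier := {g | ∀ (i : I) (c d : C), Δ.adj i (g c) (g d) ↔ Δ.adj i c d}
  one_mem' := fun _ _ _ => Iff.rfl
  mul_mem' := fun {g h} hg hh i c d => (hg i (h c) (h d)).trans (hh i c d)
  inv_mem' := fun {g} hg i c d => by
    have := hg i (g⁻¹ c) (g⁻¹ d)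
    simpa using this.symm

theorem image_mem_panel {Δ : ChamberSystem I C} (g : Δ.Aut) {i : I} {c d : C} :
    (g : Equiv.Perm C) d ∈ Δ.panel i ((g : Equiv.Perm C) c) ↔ d ∈ Δ.panel i c :=
  g.2 i c d

/-- The bijection from the `i`-panel of `c` to the `i`-panel of `g c` induced by an automorphism
`g`. -/
def panelMap {Δ : ChamberSystem I C} (g : Δ.Aut) (i : I) (c : C) :
    Δ.panel i c ≃ Δ.panel i ((g : Equiv.Perm C) c) :=
  (g : Equiv.Perm C).subtypeEquiv fun _ => (image_mem_panel g).symm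

end ChamberSystem

/-- A Coxeter matrix is right-angled if `m i j ∈ {2, ∞}` for all distinct `i`, `j`
(in Mathlib, the entry `0` stands for `∞`). -/
def CoxeterMatrix.IsRightAngled {I : Type*} (M : CoxeterMatrix I) : Prop :=
  ∀ i j : I, i ≠ j → M i j = 2 ∨ M i j = 0

/-! ### Legal colourings, local actions and universal groups -/

/-- A legal colouring of `Δ` with colour sets `X i`: on each `i`-panel, `color i` is a bijection to
`X i`, and `color j` is constant for `j ≠ i`. -/
structure LegalColouring {I C : Type*} (Δ : ChamberSystem I C) (X : I → Type*) where
  color : (i : I) → C → X i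
  bijOn : ∀ (i : I) (c : C), Set.BijOn (color i) (Δ.panel i c) Set.univ
  const : ∀ (i j : I), j ≠ i → ∀ c d : C, d ∈ Δ.panel i c → color j d = color j c

namespace LegalColouring

variable {I C : Type*} {Δ : ChamberSystem I C} {X : I → Type*}

/-- The bijection from the `i`-panel of `c` to `X i` given by the colouring. -/
noncomputable def panelEquiv (col : LegalColouring Δ X) (i : I) (c : C) : Δ.panel i c ≃ X i :=
  Equiv.ofBijective (fun d : Δ.panel i c => col.color i d)
    ⟨fun a b h => Subtype.ext ((col.bijOn i c).injOn a.2 b.2 h), fun x => by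
      obtain ⟨d, hd, hdx⟩ := (col.bijOn i c).surjOn (Set.mem_univ x)
      exact ⟨⟨d, hd⟩, hdx⟩⟩

/-- The local action of `g` at the `i`-panel `P` of `c`, i.e. the permutation
`color i |_(g P) ∘ g |_P ∘ (color i |_P)⁻¹` of `X i`. -/
noncomputable def localAction (col : LegalColouring Δ X) (g : Δ.Aut) (i : I) (c : C) :
    Equiv.Perm (X i) :=
  ((col.panelEquiv i c).symm.trans (ChamberSystem.panelMap g i c)).trans
    (col.panelEquiv i ((g : Equiv.Perm C) c))

theorem localAction_color (col : LegalColouring Δ X) (g : Δ.Aut) (i : I) (c d : C)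
    (hd : d ∈ Δ.panel i c) :
    col.localAction g i c (col.color i d) = col.color i ((g : Equiv.Perm C) d) := by
  have h : (col.panelEquiv i c).symm (col.color i d) = ⟨d, hd⟩ := by
    rw [Equiv.symm_apply_eq]; rfl
  simp only [localAction, Equiv.trans_apply, h]
  rfl

/-- The local action depends only on the panel, not on the chamber that represents it. -/
theorem localAction_congr (col : LegalColouring Δ X) (g : Δ.Aut) (i : I) (c c' : C)
    (h : c' ∈ Δ.panel i c) : col.localAction g i c' = col.localAction g i c := by
  ext x
  obtain ⟨d, hd, rfl⟩ := (col.bijOn i c').surjOn (Set.mem_univ x)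
  rw [localAction_color col g i c' d hd,
    localAction_color col g i c d ((Δ.adj i).trans' h hd)]

theorem localAction_one (col : LegalColouring Δ X) (i : I) (c : C) :
    col.localAction 1 i c = 1 := by
  ext x
  obtain ⟨d, hd, rfl⟩ := (col.bijOn i c).surjOn (Set.mem_univ x)
  rw [localAction_color col 1 i c d hd]
  rfl

theorem localAction_mul (col : LegalColouring Δ X) (g h : Δ.Aut) (i : I) (c : C) :
    col.localAction (g * h) i c =
      col.localAction g i ((h : Equiv.Perm C) c) * col.localAction h i c := by
  ext x
  obtain ⟨d, hd, rfl⟩ := (col.bijOn i c).surjOn (Set.mem_univ x)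
  rw [Equiv.Perm.mul_apply, localAction_color col (g * h) i c d hd,
    localAction_color col h i c d hd,
    localAction_color col g i _ _ ((ChamberSystem.image_mem_panel h).2 hd)]
  rfl

/-- The universal group `U(F)`: the automorphisms all of whose local actions at `i`-panels lie in
`F i`, for all `i`.  (The panels are represented by chambers that they contain.) -/
def universalGroup (col : LegalColouring Δ X) (F : (i : I) → Subgroup (Equiv.Perm (X i))) :
    Subgroup Δ.Aut where
  carrier := {g | ∀ (i : I) (c : C), col.localAction g i c ∈ F i}
  one_mem' := fun i c => by
    rw [localAction_one]; exact one_mem _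
  mul_mem' := fun {g h} hg hh i c => by
    rw [localAction_mul]; exact mul_mem (hg i _) (hh i c)
  inv_mem' := fun {g} hg i c => by
    have h := localAction_mul col g g⁻¹ i c
    rw [mul_inv_cancel, localAction_one] at h
    rw [eq_inv_of_mul_eq_one_right h.symm]
    exact inv_mem (hg i _)

end LegalColouring

/-!
The local actions of `g ∈ U(F)` at any two `i`-panels agree modulo `Fᵢ⁺`: this is clear for panels
meeting a common `j`-panel, and the building is connected. Hence the class of the local action
defines a homomorphism `U(F) → Fᵢ / Fᵢ⁺`, which is continuous. It is surjective because every
permutation of the colours of type `i` is the constant local action of an automorphism that keeps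
all other colours. A point stabiliser is open, so `Fᵢ / Fᵢ⁺` is discrete and, as a continuous image
of `U(F)`, finitely generated; lifts of its generators together with a compact generating set of
`Fᵢ⁺` generate `Fᵢ`.

The automorphisms come from the fact that whether a path prescribed by colours closes up depends
only on the colours of its starting chamber: a closed path has a type that is not reduced, and in a
right-angled Coxeter group every word that is not reduced can be shortened by commuting two equal
letters together. The latter is proved with Mozes' numbers game.
-/

/-! ### Compactly generated groups -/

namespace IsCompactlyGeneratedGroup

theorem of_surjective {G H : Type*} [Group G] [TopologicalSpace G] [Group H] [TopologicalSpace H]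
    (hG : IsCompactlyGeneratedGroup G) {f : G →* H} (hf : Continuous f)
    (hsurj : Function.Surjective f) : IsCompactlyGeneratedGroup H := by
  obtain ⟨Q, hQ, hQG⟩ := hG
  refine ⟨f '' Q, hQ.image hf, ?_⟩
  rw [← MonoidHom.map_closure, hQG, Subgroup.map_top_of_surjective f hsurj]

theorem of_isOpen_of_quotient {G : Type*} [Group G] [TopologicalSpace G]
    [SeparatelyContinuousMul G] {N : Subgroup G} [N.Normal] (hopen : IsOpen (N : Set G))
    (hN : IsCompactlyGeneratedGroup N) (hquot : IsCompactlyGeneratedGroup (G ⧸ N)) :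
    IsCompactlyGeneratedGroup G := by
  obtain ⟨K, hK, hKN⟩ := hN
  obtain ⟨Q, hQ, hQtop⟩ := hquot
  have : DiscreteTopology (G ⧸ N) := QuotientGroup.discreteTopology hopen
  have hQfin : Q.Finite := hQ.finite_of_discrete
  set S : Set G := (↑) '' K ∪ Quotient.out '' Q
  refine ⟨S, (hK.image continuous_subtype_val).union (hQfin.image _).isCompact, ?_⟩
  have hNS : N ≤ Subgroup.closure S := calc
    N = (Subgroup.closure K).map N.subtype := by
      rw [hKN, ← MonoidHom.range_eq_map, Subgroup.range_subtype]
    _ = Subgroup.closure ((↑) '' K) := MonoidHom.map_closure _ _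
    _ ≤ Subgroup.closure S := Subgroup.closure_mono Set.subset_union_left
  have hQS : Q ⊆ QuotientGroup.mk' N '' S := fun q hq =>
    ⟨q.out, Or.inr ⟨q, hq, rfl⟩, QuotientGroup.out_eq' q⟩
  have hmap : (Subgroup.closure S).map (QuotientGroup.mk' N) = ⊤ := by
    rw [MonoidHom.map_closure, eq_top_iff, ← hQtop]
    exact Subgroup.closure_mono hQS
  rw [← sup_eq_right.2 hNS, ← QuotientGroup.comap_map_mk', hmap, Subgroup.comap_top]

end IsCompactlyGeneratedGroup

/-! ### Permutation groups -/

theorem continuous_perm_iff {X Y : Type*} [TopologicalSpace Y] {f : Y → Equiv.Perm X} :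
    Continuous f ↔ ∀ x, IsLocallyConstant fun y => f y x := by
  let _ : TopologicalSpace X := ⊥
  have : DiscreteTopology X := ⟨rfl⟩
  simp only [IsLocallyConstant.iff_continuous]
  exact continuous_induced_rng.trans continuous_pi_iff

section PlusSubgroup

variable {X : Type*} {F : Subgroup (Equiv.Perm X)}

theorem inv_mul_mem_plusSubgroup {f g : F} {x : X}
    (h : (f : Equiv.Perm X) x = (g : Equiv.Perm X) x) : f⁻¹ * g ∈ plusSubgroup F :=
  Subgroup.subset_closure ⟨x, Equiv.Perm.inv_eq_iff_eq.2 h.symm⟩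

instance plusSubgroup_normal : (plusSubgroup F).Normal where
  conj_mem f hf g := by
    suffices plusSubgroup F ≤ (plusSubgroup F).comap (MulAut.conj g).toMonoidHom from this hf
    refine (Subgroup.closure_le _).2 ?_
    rintro f ⟨x, hx⟩
    exact Subgroup.subset_closure ⟨(g : Equiv.Perm X) x, by simp [hx]⟩

variable (F) in
theorem isOpen_plusSubgroup : IsOpen (plusSubgroup F : Set F) := by
  cases isEmpty_or_nonempty X with
  | inl _ =>
    have : DiscreteTopology F := Subsingleton.discreteTopology
    exact isOpen_discrete _
  | inr hX =>
    obtain ⟨x⟩ := hX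
    refine Subgroup.isOpen_of_mem_nhds _ (g := 1) ?_
    refine (permTopology_hasBasis_nhds_one F).mem_iff.2 ⟨{x}, trivial, fun f hf => ?_⟩
    exact Subgroup.subset_closure ⟨x, hf x (Finset.mem_singleton_self x)⟩

end PlusSubgroup

/-! ### Reduced words in right-angled Coxeter groups -/

/-- A word is tight if it has no factor `s β s` in which every letter of `β` commutes with `s`;
equivalently, commutation moves never bring two equal letters next to each other. In a right-angled
Coxeter group this is the combinatorial counterpart of being reduced. -/
def IsTightWord {I : Type*} (M : CoxeterMatrix I) (ω : List I) : Prop :=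
  ∀ (s : I) (β : List I), s :: (β ++ [s]) <:+: ω → ∃ t ∈ β, M s t ≠ 2

/-- The move at the node `s` of Mozes' numbers game: the label of `s` changes sign, and twice the
old label of `s` is added to the label of each node that does not commute with `s`. (The entry
`M s t` is `1` exactly when `t = s`.) -/
def fireNode {I : Type*} (M : CoxeterMatrix I) (s : I) (x : I → ℤ) : I → ℤ := fun t =>
  if M s t = 1 then -x t else if M s t = 2 then x t else x t + 2 * x s

section Coxeter

variable {I : Type*} {M : CoxeterMatrix I}

namespace IsTightWord

theorem of_infix {ω ω' : List I} (h : IsTightWord M ω) (hω' : ω' <:+: ω) : IsTightWord M ω' :=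
  fun s β hβ => h s β (hβ.trans hω')

theorem of_cons {s : I} {ω : List I} (h : IsTightWord M (s :: ω)) : IsTightWord M ω :=
  h.of_infix (List.suffix_cons s ω).isInfix

theorem ne_of_cons_cons {s t : I} {ω : List I} (h : IsTightWord M (s :: t :: ω)) : s ≠ t := by
  rintro rfl
  obtain ⟨t, ht, -⟩ := h s [] ⟨[], ω, rfl⟩
  exact List.not_mem_nil ht

theorem of_cons_cons_of_commute {s t : I} {ω : List I} (h : IsTightWord M (s :: t :: ω))
    (hst : M s t = 2) : IsTightWord M (s :: ω) := by
  intro r β hβ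
  rcases List.infix_cons_iff.1 hβ with hpre | hinf
  · obtain ⟨rfl, hβω⟩ := List.cons_prefix_cons.1 hpre
    obtain ⟨u, hu, hru⟩ := h r (t :: β)
      (List.cons_prefix_cons.2 ⟨rfl, List.cons_prefix_cons.2 ⟨rfl, hβω⟩⟩).isInfix
    rcases List.mem_cons.1 hu with rfl | hu
    · exact absurd hst hru
    · exact ⟨u, hu, hru⟩
  · exact h.of_cons.of_cons r β hinf

theorem pair {s t : I} (hst : s ≠ t) : IsTightWord M [s, t] := by
  intro r β hβ
  have hlen : β.length + 2 ≤ 2 := by simpa using hβ.length_le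
  obtain rfl : β = [] := List.eq_nil_of_length_eq_zero (by omega)
  obtain ⟨rfl, rfl⟩ : r = s ∧ r = t := by simpa using hβ.eq_of_length rfl
  exact absurd rfl hst

end IsTightWord

theorem exists_eq_append_of_not_isTightWord_map {α : Type*} {f : α → I} {w : List α}
    (hw : ¬ IsTightWord M (w.map f)) :
    ∃ (u v z : List α) (p q : α), w = u ++ p :: (v ++ q :: z) ∧ f p = f q ∧
      ∀ r ∈ v, M (f p) (f r) = 2 := by
  simp only [IsTightWord, not_forall, not_exists, not_and, not_not] at hw
  obtain ⟨s, β, ⟨γ, δ, hγδ⟩, hβ⟩ := hw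
  have hmap : w.map f = γ ++ s :: (β ++ s :: δ) := by rw [← hγδ]; simp
  obtain ⟨u, w₁, rfl, -, h₁⟩ := List.map_eq_append_iff.1 hmap
  obtain ⟨p, w₂, rfl, rfl, h₂⟩ := List.map_eq_cons_iff.1 h₁
  obtain ⟨v, w₃, rfl, rfl, h₃⟩ := List.map_eq_append_iff.1 h₂
  obtain ⟨q, z, rfl, hq, -⟩ := List.map_eq_cons_iff.1 h₃
  exact ⟨u, v, z, p, q, rfl, hq.symm, fun r hr => hβ _ (List.mem_map_of_mem hr)⟩

theorem fireNode_self (s : I) (x : I → ℤ) : fireNode M s x s = -x s := by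
  simp [fireNode]

theorem fireNode_of_commute {s t : I} (h : M s t = 2) (x : I → ℤ) : fireNode M s x t = x t := by
  simp [fireNode, h]

theorem fireNode_of_not_commute {s t : I} (hne : s ≠ t) (h : M s t ≠ 2) (x : I → ℤ) :
    fireNode M s x t = x t + 2 * x s := by
  simp [fireNode, h, M.off_diagonal s t hne]

theorem fireNode_fireNode (s : I) (x : I → ℤ) : fireNode M s (fireNode M s x) = x := by
  funext t
  rcases eq_or_ne s t with rfl | hne
  · simp only [fireNode_self, neg_neg]
  by_cases hst : M s t = 2
  · simp only [fireNode_of_commute hst]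
  · simp only [fireNode_of_not_commute hne hst, fireNode_self]
    ring

theorem fireNode_comm {s t : I} (hst : M s t = 2) (x : I → ℤ) :
    fireNode M s (fireNode M t x) = fireNode M t (fireNode M s x) := by
  have hts : M t s = 2 := by rw [M.symmetric, hst]
  have hs := fireNode_of_commute hts x
  have ht := fireNode_of_commute hst x
  funext r
  rcases eq_or_ne s r with rfl | hsr
  · simp only [fireNode_self, fireNode_of_commute hts]
  rcases eq_or_ne t r with rfl | htr
  · simp only [fireNode_self, fireNode_of_commute hst]
  by_cases hs2 : M s r = 2 <;> by_cases ht2 : M t r = 2 <;>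
    simp only [fireNode_of_commute, fireNode_of_not_commute, hs, ht, hsr, htr, hs2, ht2, ne_eq,
      not_false_eq_true]
  ring

theorem isLiftable_fireNode (hM : M.IsRightAngled) :
    M.IsLiftable (G := Function.End (I → ℤ)) (fireNode M) := by
  intro s t
  rcases eq_or_ne s t with rfl | hst
  · rw [M.diagonal, pow_one]
    exact funext (fireNode_fireNode s)
  rcases hM s t hst with h | h
  · rw [h, pow_two]
    funext x
    change fireNode M s (fireNode M t (fireNode M s (fireNode M t x))) = x
    rw [fireNode_comm h, fireNode_fireNode, fireNode_fireNode]
  · rw [h, pow_zero]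

variable {W : Type*} [Group W] (cs : CoxeterSystem M W)

/-- The action of a right-angled Coxeter group on integer labellings of the nodes in which the
simple reflections act by the moves of the numbers game. -/
noncomputable def numbersGame (hM : M.IsRightAngled) : W →* Function.End (I → ℤ) :=
  cs.lift ⟨fireNode M, isLiftable_fireNode hM⟩

theorem numbersGame_wordProd_cons (hM : M.IsRightAngled) (s : I) (ω : List I) (x : I → ℤ) :
    numbersGame cs hM (cs.wordProd (s :: ω)) x =
      fireNode M s (numbersGame cs hM (cs.wordProd ω) x) := by
  have hs : numbersGame cs hM (cs.simple s) = fireNode M s :=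
    cs.lift_apply_simple (isLiftable_fireNode hM) s
  rw [cs.wordProd_cons, map_mul, hs]
  rfl

theorem fireNode_add_pos {x : I → ℤ} {t : I} (ht : 0 < x t)
    (hx : ∀ a b, a ≠ b → M a b ≠ 2 → 0 < x a + x b) {a b : I} (hne : a ≠ b) (hab : M a b ≠ 2) :
    0 < fireNode M t x a + fireNode M t x b := by
  have hpos := hx a b hne hab
  have hmono : ∀ r, r ≠ t → x r ≤ fireNode M t x r := by
    intro r hr
    by_cases h2 : M t r = 2
    · rw [fireNode_of_commute h2]
    · rw [fireNode_of_not_commute hr.symm h2]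
      omega
  rcases eq_or_ne a t with rfl | ha
  · rw [fireNode_self, fireNode_of_not_commute hne hab]
    omega
  rcases eq_or_ne b t with rfl | hb
  · rw [fireNode_self, fireNode_of_not_commute hne.symm (by rwa [M.symmetric])]
    omega
  · have := hmono a ha
    have := hmono b hb
    omega

namespace IsTightWord

-- The first conjunct is the invariant that makes the induction for the second one go through: for
-- two non-commuting nodes, firing one of them leaves the sum of their labels unchanged.
theorem numbersGame_invariant (hM : M.IsRightAngled) {ω : List I} (hω : IsTightWord M ω) :
    (∀ a b, a ≠ b → M a b ≠ 2 → 0 < numbersGame cs hM (cs.wordProd ω) 1 a +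
      numbersGame cs hM (cs.wordProd ω) 1 b) ∧
    ∀ s, IsTightWord M (s :: ω) → 0 < numbersGame cs hM (cs.wordProd ω) 1 s := by
  induction ω with
  | nil =>
    rw [cs.wordProd_nil, map_one]
    exact ⟨fun a b _ _ => by simp [Function.End.one_def], fun s _ => by simp [Function.End.one_def]⟩
  | cons t ω ih =>
    obtain ⟨hsum, hpos⟩ := ih hω.of_cons
    have ht := hpos t hω
    simp only [numbersGame_wordProd_cons]
    refine ⟨fun a b => fireNode_add_pos ht hsum, fun s hs => ?_⟩
    by_cases hts : M t s = 2
    · rw [fireNode_of_commute hts]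
      exact hpos s (hs.of_cons_cons_of_commute (by rwa [M.symmetric]))
    · have hne : t ≠ s := hs.ne_of_cons_cons.symm
      have := hsum t s hne hts
      rw [fireNode_of_not_commute hne hts]
      omega

theorem numbersGame_pos (hM : M.IsRightAngled) {s : I} {ω : List I}
    (h : IsTightWord M (s :: ω)) : 0 < numbersGame cs hM (cs.wordProd ω) 1 s :=
  (h.of_cons.numbersGame_invariant cs hM).2 s h

variable {cs}

theorem of_isReduced {ω : List I} (hω : cs.IsReduced ω) : IsTightWord M ω := by
  rintro s β ⟨γ, δ, rfl⟩
  by_contra! hβ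
  have hcomm : Commute (cs.simple s) (cs.wordProd β) := by
    refine Commute.list_prod_right _ _ fun w hw => ?_
    obtain ⟨t, ht, rfl⟩ := List.mem_map.1 hw
    have hpow := cs.simple_mul_simple_pow s t
    rw [hβ t ht, pow_two, mul_eq_one_iff_eq_inv, mul_inv_rev, cs.inv_simple, cs.inv_simple] at hpow
    exact hpow
  have hprod : cs.wordProd (γ ++ s :: (β ++ [s]) ++ δ) = cs.wordProd (γ ++ β ++ δ) := by
    simp only [cs.wordProd_append, cs.wordProd_cons, cs.wordProd_nil, mul_one]
    rw [← hcomm.eq, cs.simple_mul_simple_cancel_left]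
  have hlen := cs.length_wordProd_le (γ ++ β ++ δ)
  rw [← hprod, hω.eq] at hlen
  simp only [List.length_append, List.length_cons, List.length_nil] at hlen
  omega

theorem isReduced (hM : M.IsRightAngled) {ω : List I} (hω : IsTightWord M ω) :
    cs.IsReduced ω := by
  induction ω with
  | nil => simp [CoxeterSystem.IsReduced]
  | cons s ω ih =>
    have hω_red : cs.IsReduced ω := ih hω.of_cons
    rcases cs.length_simple_mul (cs.wordProd ω) s with hlong | hshort
    · rw [CoxeterSystem.IsReduced, cs.wordProd_cons, hlong, hω_red.eq, List.length_cons]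
    -- Otherwise `ω` also has a reduced expression starting with `s`, so that `s` was the last node
    -- to be fired: its label is then negative, while tightness of `s :: ω` makes it positive.
    obtain ⟨ω', hω', hprod⟩ := cs.exists_isReduced (cs.simple s * cs.wordProd ω)
    have hsω' : cs.wordProd (s :: ω') = cs.wordProd ω := by
      rw [cs.wordProd_cons, ← hprod, cs.simple_mul_simple_cancel_left]
    have hsω'_red : cs.IsReduced (s :: ω') := by
      rw [CoxeterSystem.IsReduced, hsω', ← hshort, hprod, hω'.eq, List.length_cons]
    have hpos' := (of_isReduced hsω'_red).numbersGame_pos cs hM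
    have hpos := hω.numbersGame_pos cs hM
    rw [← hsω', numbersGame_wordProd_cons, fireNode_self] at hpos
    omega

end IsTightWord

end Coxeter

/-! ### Galleries -/

/-- A chamber system is connected if any two chambers are joined by a gallery. -/
def ChamberSystem.IsConnected {I C : Type*} (Δ : ChamberSystem I C) : Prop :=
  ∀ c d : C, ∃ ω, Δ.Gallery ω c d

namespace ChamberSystem.IsBuilding

variable {I C : Type*} {Δ : ChamberSystem I C} {M : CoxeterMatrix I}

theorem isConnected (hΔ : Δ.IsBuilding M) : Δ.IsConnected := by
  obtain ⟨-, -, δ, hδ⟩ := hΔ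
  intro c d
  obtain ⟨ω, hω, hcd⟩ := M.toCoxeterSystem.exists_isReduced (δ c d)
  exact ⟨ω, (hδ c d ω hω).1 hcd⟩

theorem eq_nil_of_gallery_self (hΔ : Δ.IsBuilding M) {ω : List I}
    (hω : M.toCoxeterSystem.IsReduced ω) {c : C} (hc : Δ.Gallery ω c c) : ω = [] := by
  obtain ⟨-, -, δ, hδ⟩ := hΔ
  have hnil : δ c c = M.toCoxeterSystem.wordProd [] :=
    (hδ c c [] (by simp [CoxeterSystem.IsReduced])).2 (.nil c)
  have hlen := hω.eq
  rw [← (hδ c c ω hω).2 hc, hnil] at hlen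
  simpa using hlen.symm

theorem exists_adj_adj_of_commute (hM : M.IsRightAngled) (hΔ : Δ.IsBuilding M) {i j : I}
    (hij : M i j = 2) {c d e : C} (hcd : Δ.adj i c d) (hde : Δ.adj j d e) :
    ∃ d', Δ.adj j c d' ∧ Δ.adj i d' e := by
  rcases eq_or_ne c d with rfl | hne_cd
  · exact ⟨e, hde, (Δ.adj i).refl e⟩
  rcases eq_or_ne d e with rfl | hne_de
  · exact ⟨c, (Δ.adj j).refl c, hcd⟩
  have hne : i ≠ j := by
    rintro rfl
    simp at hij
  obtain ⟨-, -, δ, hδ⟩ := hΔ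
  let cs := M.toCoxeterSystem
  have hcomm : cs.wordProd [i, j] = cs.wordProd [j, i] := by
    have hpow := cs.simple_mul_simple_pow i j
    rw [hij, pow_two, mul_eq_one_iff_eq_inv, mul_inv_rev, cs.inv_simple, cs.inv_simple] at hpow
    simpa [CoxeterSystem.wordProd] using hpow
  have hgal : Δ.Gallery [i, j] c e := .cons hcd hne_cd (.cons hde hne_de (.nil e))
  rw [← hδ c e _ ((IsTightWord.pair hne).isReduced hM), hcomm,
    hδ c e _ ((IsTightWord.pair hne.symm).isReduced hM)] at hgal
  obtain _ | ⟨hcd', -, _ | ⟨hde', -, _ | _⟩⟩ := hgal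
  exact ⟨_, hcd', hde'⟩

end ChamberSystem.IsBuilding

/-! ### Coloured words -/

namespace LegalColouring

section Step

variable {I C : Type*} {Δ : ChamberSystem I C} {X : I → Type*} (col : LegalColouring Δ X)

/-- The chamber of colour `p.2` in the `p.1`-panel of `c`. -/
noncomputable def step (c : C) (p : Σ j, X j) : C :=
  (col.panelEquiv p.1 c).symm p.2

theorem adj_step (c : C) (p : Σ j, X j) : Δ.adj p.1 c (col.step c p) :=
  ((col.panelEquiv p.1 c).symm p.2).2

theorem color_step_self (c : C) (p : Σ j, X j) : col.color p.1 (col.step c p) = p.2 :=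
  (col.panelEquiv p.1 c).apply_symm_apply p.2

theorem color_step_of_ne (c : C) (p : Σ j, X j) {j : I} (hj : j ≠ p.1) :
    col.color j (col.step c p) = col.color j c :=
  col.const p.1 j hj c _ (col.adj_step c p)

theorem step_eq_of_adj {c d : C} {p : Σ j, X j} (hcd : Δ.adj p.1 c d)
    (hp : col.color p.1 d = p.2) : col.step c p = d :=
  (col.bijOn p.1 c).injOn (col.adj_step c p) hcd (by rw [color_step_self, hp])

theorem step_color_eq_of_adj {j : I} {c d : C} (hcd : Δ.adj j c d) :
    col.step c ⟨j, col.color j d⟩ = d :=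
  col.step_eq_of_adj hcd rfl

theorem step_eq_self {c : C} {p : Σ j, X j} (hp : col.color p.1 c = p.2) : col.step c p = c :=
  col.step_eq_of_adj ((Δ.adj p.1).refl c) hp

theorem step_step_of_eq (c : C) {p q : Σ j, X j} (hpq : p.1 = q.1) :
    col.step (col.step c p) q = col.step c q := by
  refine col.step_eq_of_adj ?_ (col.color_step_self c q)
  exact (Δ.adj q.1).trans' ((Δ.adj q.1).symm' (hpq ▸ col.adj_step c p)) (col.adj_step c q)

theorem step_comm {M : CoxeterMatrix I} (hM : M.IsRightAngled) (hΔ : Δ.IsBuilding M) (c : C)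
    {p q : Σ j, X j} (hpq : M p.1 q.1 = 2) :
    col.step (col.step c p) q = col.step (col.step c q) p := by
  have hne : p.1 ≠ q.1 := fun h => by simp [h] at hpq
  obtain ⟨d, hcd, hde⟩ :=
    hΔ.exists_adj_adj_of_commute hM hpq (col.adj_step c p) (col.adj_step (col.step c p) q)
  have hd : col.step c q = d := col.step_eq_of_adj hcd <| by
    rw [← col.const p.1 q.1 hne.symm d _ hde, color_step_self]
  rw [hd]
  refine (col.step_eq_of_adj hde ?_).symm
  rw [color_step_of_ne _ _ _ hne, color_step_self]

/-- The chamber reached from `c` by following a coloured word, where a letter `⟨j, x⟩` moves to the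
chamber of colour `x` in the current `j`-panel. -/
noncomputable def run (c : C) (w : List (Σ j, X j)) : C :=
  w.foldl col.step c

@[simp] theorem run_nil (c : C) : col.run c [] = c := rfl

@[simp] theorem run_cons (c : C) (p : Σ j, X j) (w : List (Σ j, X j)) :
    col.run c (p :: w) = col.run (col.step c p) w := rfl

@[simp] theorem run_append (c : C) (w v : List (Σ j, X j)) :
    col.run c (w ++ v) = col.run (col.run c w) v :=
  List.foldl_append

theorem exists_run_eq (hΔ : Δ.IsConnected) (c d : C) : ∃ w, col.run c w = d := by
  obtain ⟨ω, hω⟩ := hΔ c d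
  induction hω with
  | nil c => exact ⟨[], rfl⟩
  | @cons i _ _ d _ hcd _ _ ih =>
    obtain ⟨w, hw⟩ := ih
    exact ⟨⟨i, col.color i d⟩ :: w, by rw [run_cons, col.step_color_eq_of_adj hcd, hw]⟩

theorem run_step_comm {M : CoxeterMatrix I} (hM : M.IsRightAngled) (hΔ : Δ.IsBuilding M)
    {p : Σ j, X j} {w : List (Σ j, X j)} (hw : ∀ q ∈ w, M p.1 q.1 = 2) (c : C) :
    col.run (col.step c p) w = col.step (col.run c w) p := by
  induction w generalizing c with
  | nil => rfl
  | cons q w ih =>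
    obtain ⟨hq, hw⟩ := List.forall_mem_cons.1 hw
    rw [run_cons, run_cons, col.step_comm hM hΔ c hq, ih hw]

theorem run_cancel {M : CoxeterMatrix I} (hM : M.IsRightAngled) (hΔ : Δ.IsBuilding M)
    {p q : Σ j, X j} (hpq : p.1 = q.1) {v : List (Σ j, X j)} (hv : ∀ r ∈ v, M p.1 r.1 = 2)
    (c : C) (u z : List (Σ j, X j)) :
    col.run c (u ++ p :: (v ++ q :: z)) = col.run c (u ++ (v ++ q :: z)) := by
  simp only [run_append, run_cons]
  rw [col.run_step_comm hM hΔ hv, col.step_step_of_eq _ hpq]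

theorem gallery_run (w : List (Σ j, X j)) (c : C)
    (hw : ∀ v p u, w = v ++ p :: u → col.color p.1 (col.run c v) ≠ p.2) :
    Δ.Gallery (w.map Sigma.fst) c (col.run c w) := by
  induction w generalizing c with
  | nil => exact .nil c
  | cons p w ih =>
    refine .cons (col.adj_step c p) (fun hc => hw [] p w rfl ?_)
      (ih _ fun v q u hvq => hw (p :: v) q u (by rw [hvq, List.cons_append]))
    rw [run_nil, hc, color_step_self]

end Step

section Transfer

variable {I : Type*} {M : CoxeterMatrix I} {X : I → Type*} {C C' : Type*}
  {Δ : ChamberSystem I C} {Δ' : ChamberSystem I C'}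
  {col : LegalColouring Δ X} {col' : LegalColouring Δ' X} {c : C} {c' : C'}

theorem color_step_congr (h : ∀ j, col.color j c = col'.color j c') (p : Σ j, X j) (j : I) :
    col.color j (col.step c p) = col'.color j (col'.step c' p) := by
  rcases eq_or_ne j p.1 with rfl | hj
  · rw [color_step_self, color_step_self]
  · rw [color_step_of_ne _ _ _ hj, color_step_of_ne _ _ _ hj, h]

theorem color_run_congr (h : ∀ j, col.color j c = col'.color j c') (w : List (Σ j, X j)) :
    ∀ j, col.color j (col.run c w) = col'.color j (col'.run c' w) := by
  induction w generalizing c c' with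
  | nil => exact h
  | cons p _ ih => exact ih (color_step_congr h p)

-- A shortest counterexample never stutters, so it traces a gallery, and its type is tight, hence
-- reduced; but a closed gallery of reduced type is empty.
theorem run_eq_self_congr (hM : M.IsRightAngled) (hΔ : Δ.IsBuilding M) (hΔ' : Δ'.IsBuilding M)
    (h : ∀ j, col.color j c = col'.color j c') (w : List (Σ j, X j)) (hw : col.run c w = c) :
    col'.run c' w = c' := by
  induction hn : w.length using Nat.strong_induction_on generalizing w with
  | _ n ih =>
  subst hn
  by_cases hstutter : ∃ v p u, w = v ++ p :: u ∧ col.color p.1 (col.run c v) = p.2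
  · obtain ⟨v, p, u, rfl, hp⟩ := hstutter
    have hp' : col'.color p.1 (col'.run c' v) = p.2 := by rw [← color_run_congr h, hp]
    rw [run_append, run_cons, col.step_eq_self hp, ← run_append] at hw
    rw [run_append, run_cons, col'.step_eq_self hp', ← run_append]
    exact ih _ (by simp) _ hw rfl
  by_cases htight : IsTightWord M (w.map Sigma.fst)
  · have hgal := col.gallery_run w c fun v p u hv hp => hstutter ⟨v, p, u, hv, hp⟩
    rw [hw] at hgal
    rw [List.map_eq_nil_iff.1 (hΔ.eq_nil_of_gallery_self (htight.isReduced hM) hgal), run_nil]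
  · obtain ⟨u, v, z, p, q, rfl, hpq, hv⟩ := exists_eq_append_of_not_isTightWord_map htight
    rw [col.run_cancel hM hΔ hpq hv] at hw
    rw [col'.run_cancel hM hΔ' hpq hv]
    exact ih _ (by simp) _ hw rfl

theorem run_eq_run_congr (hM : M.IsRightAngled) (hΔ : Δ.IsBuilding M) (hΔ' : Δ'.IsBuilding M)
    (h : ∀ j, col.color j c = col'.color j c') {w v : List (Σ j, X j)}
    (hwv : col.run c w = col.run c v) : col'.run c' w = col'.run c' v := by
  obtain ⟨u, hu⟩ := col.exists_run_eq hΔ.isConnected (col.run c v) c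
  have hvu : col'.run (col'.run c' v) u = c' := by
    rw [← run_append]
    exact run_eq_self_congr hM hΔ hΔ' h _ (by rw [run_append, hu])
  have huw : col'.run (col'.run c' v) (u ++ w) = col'.run c' v :=
    run_eq_self_congr hM hΔ hΔ' (color_run_congr h v) _ (by rw [run_append, hu, hwv])
  rwa [run_append, hvu] at huw

theorem exists_map_run (hM : M.IsRightAngled) (hΔ : Δ.IsBuilding M) (hΔ' : Δ'.IsBuilding M)
    (h : ∀ j, col.color j c = col'.color j c') :
    ∃ φ : C → C', ∀ w, φ (col.run c w) = col'.run c' w := by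
  choose w hw using col.exists_run_eq hΔ.isConnected c
  exact ⟨fun d => col'.run c' (w d), fun v => run_eq_run_congr hM hΔ hΔ' h (hw _)⟩

theorem adj_of_map_run (hΔ : Δ.IsConnected) {φ : C → C'}
    (hφ : ∀ w, φ (col.run c w) = col'.run c' w) {j : I} {d e : C} (hde : Δ.adj j d e) :
    Δ'.adj j (φ d) (φ e) := by
  obtain ⟨w, rfl⟩ := col.exists_run_eq hΔ c d
  have he : φ e = col'.step (φ (col.run c w)) ⟨j, col.color j e⟩ := by
    have := hφ (w ++ [⟨j, col.color j e⟩])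
    rwa [run_append, run_cons, run_nil, col.step_color_eq_of_adj hde, run_append, ← hφ] at this
  rw [he]
  exact col'.adj_step _ ⟨j, col.color j e⟩

theorem exists_equiv_color_eq (hM : M.IsRightAngled) (hΔ : Δ.IsBuilding M)
    (hΔ' : Δ'.IsBuilding M) (h : ∀ j, col.color j c = col'.color j c') :
    ∃ φ : C ≃ C', (∀ j d e, Δ'.adj j (φ d) (φ e) ↔ Δ.adj j d e) ∧
      ∀ j d, col'.color j (φ d) = col.color j d := by
  obtain ⟨φ, hφ⟩ := exists_map_run hM hΔ hΔ' h
  obtain ⟨ψ, hψ⟩ := exists_map_run hM hΔ' hΔ fun j => (h j).symm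
  have hψφ : Function.LeftInverse ψ φ := fun d => by
    obtain ⟨w, rfl⟩ := col.exists_run_eq hΔ.isConnected c d
    rw [hφ, hψ]
  have hφψ : Function.RightInverse ψ φ := fun d => by
    obtain ⟨w, rfl⟩ := col'.exists_run_eq hΔ'.isConnected c' d
    rw [hψ, hφ]
  refine ⟨⟨φ, ψ, hψφ, hφψ⟩, fun j d e => ⟨fun hde => ?_, adj_of_map_run hΔ.isConnected hφ⟩,
    fun j d => ?_⟩
  · have hde' : Δ.adj j (ψ (φ d)) (ψ (φ e)) := adj_of_map_run hΔ'.isConnected hψ hde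
    rwa [hψφ, hψφ] at hde'
  · obtain ⟨w, rfl⟩ := col.exists_run_eq hΔ.isConnected c d
    exact (congrArg _ (hφ w)).trans (color_run_congr h w j).symm

end Transfer

/-! ### Local actions -/

section LocalAction

variable {I C : Type*} {Δ : ChamberSystem I C} {X : I → Type*} (col : LegalColouring Δ X)

/-- The legal colouring obtained by applying a permutation `φ j` of the colours to each
coordinate. -/
def recolour (φ : ∀ j, Equiv.Perm (X j)) : LegalColouring Δ X where
  color j c := φ j (col.color j c)
  bijOn j c := (Set.bijOn_univ.2 (φ j).bijective).comp (col.bijOn j c)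
  const j k hk c d hd := by rw [col.const j k hk c d hd]

theorem exists_aut_localAction_eq {M : CoxeterMatrix I} (hM : M.IsRightAngled)
    (hΔ : Δ.IsBuilding M) {φ : ∀ j, Equiv.Perm (X j)} {c c' : C}
    (h : ∀ j, φ j (col.color j c) = col.color j c') :
    ∃ g : Δ.Aut, ∀ j d, col.localAction g j d = φ j := by
  obtain ⟨g, hadj, hcolor⟩ := exists_equiv_color_eq (col := col.recolour φ) hM hΔ hΔ h
  refine ⟨⟨g, hadj⟩, fun j d => Equiv.ext fun x => ?_⟩
  obtain ⟨e, he, rfl⟩ := (col.bijOn j d).surjOn (Set.mem_univ x)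
  rw [localAction_color col _ j d e he]
  exact hcolor j e

theorem localAction_color_self (g : Δ.Aut) (i : I) (c : C) :
    col.localAction g i c (col.color i c) = col.color i ((g : Equiv.Perm C) c) :=
  col.localAction_color g i c c ((Δ.adj i).refl c)

theorem continuous_localAction (i : I) (c : C) :
    Continuous fun g : Δ.Aut => col.localAction g i c := by
  refine continuous_perm_iff.2 fun x => ?_
  obtain ⟨d, hd, rfl⟩ := (col.bijOn i c).surjOn (Set.mem_univ x)
  simp only [col.localAction_color _ i c d hd]
  exact (continuous_perm_iff.1 continuous_subtype_val d).comp (col.color i)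

variable {F : (i : I) → Subgroup (Equiv.Perm (X i))}

/-- The local action of an element of the universal group, as an element of the local group. -/
noncomputable def localActionIn (g : col.universalGroup F) (i : I) (c : C) : F i :=
  ⟨col.localAction g i c, g.2 i c⟩

theorem localActionIn_mul (g h : col.universalGroup F) (i : I) (c : C) :
    col.localActionIn (g * h) i c =
      col.localActionIn g i (((h : Δ.Aut) : Equiv.Perm C) c) * col.localActionIn h i c :=
  Subtype.ext (col.localAction_mul g h i c)

theorem continuous_localActionIn (i : I) (c : C) :
    Continuous fun g : col.universalGroup F => col.localActionIn g i c :=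
  ((col.continuous_localAction i c).comp continuous_subtype_val).subtype_mk _

theorem surjective_localActionIn {M : CoxeterMatrix I} (hM : M.IsRightAngled)
    (hΔ : Δ.IsBuilding M) (i : I) (c : C) :
    Function.Surjective fun g : col.universalGroup F => col.localActionIn g i c := by
  classical
  intro f
  let φ : ∀ j, Equiv.Perm (X j) := Pi.mulSingle i (f : Equiv.Perm (X i))
  have hφ : ∀ j, φ j ∈ F j := fun j => by
    rcases eq_or_ne j i with rfl | hj
    · simp [φ]
    · simp [φ, hj, one_mem]
  have hcolor : ∀ j, φ j (col.color j c) =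
      col.color j (col.step c ⟨i, φ i (col.color i c)⟩) := fun j => by
    rcases eq_or_ne j i with rfl | hj
    · exact (col.color_step_self c ⟨j, _⟩).symm
    · rw [color_step_of_ne _ _ _ hj]
      simp [φ, hj]
  obtain ⟨g, hg⟩ := col.exists_aut_localAction_eq hM hΔ hcolor
  refine ⟨⟨g, fun j d => hg j d ▸ hφ j⟩, Subtype.ext ((hg i c).trans ?_)⟩
  simp [φ]

-- Across a `j`-panel with `j ≠ i` the colour `x` of type `i` is constant, before and after applying
-- `g`; so the two local actions of `g` agree at `x`.
theorem mk_localActionIn_eq_of_adj (g : col.universalGroup F) (i : I) {j : I} {c d : C}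
    (hcd : Δ.adj j c d) :
    (col.localActionIn g i c : F i ⧸ plusSubgroup (F i)) = col.localActionIn g i d := by
  rcases eq_or_ne i j with rfl | hij
  · exact congrArg _ (Subtype.ext (col.localAction_congr g i c d hcd).symm)
  refine QuotientGroup.eq.2 (inv_mul_mem_plusSubgroup (x := col.color i c) ?_)
  calc col.localAction g i c (col.color i c)
    _ = col.color i (((g : Δ.Aut) : Equiv.Perm C) c) := col.localAction_color_self g i c
    _ = col.color i (((g : Δ.Aut) : Equiv.Perm C) d) :=
      (col.const j i hij _ _ ((ChamberSystem.image_mem_panel (g : Δ.Aut)).2 hcd)).symm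
    _ = col.localAction g i d (col.color i d) := (col.localAction_color_self g i d).symm
    _ = col.localAction g i d (col.color i c) := by rw [col.const j i hij c d hcd]

theorem mk_localActionIn_eq (hΔ : Δ.IsConnected) (g : col.universalGroup F) (i : I) (c d : C) :
    (col.localActionIn g i c : F i ⧸ plusSubgroup (F i)) = col.localActionIn g i d := by
  obtain ⟨ω, hω⟩ := hΔ c d
  induction hω with
  | nil c => rfl
  | cons hcd _ _ ih => exact (col.mk_localActionIn_eq_of_adj g i hcd).trans ih

/-- The homomorphism `U(F) → Fᵢ / Fᵢ⁺` sending `g` to the class of its local action at the `i`-panel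
of `c`, which is the same class for all `i`-panels. -/
noncomputable def localActionQuotient (hΔ : Δ.IsConnected)
    (F : (i : I) → Subgroup (Equiv.Perm (X i))) (i : I) (c : C) :
    col.universalGroup F →* F i ⧸ plusSubgroup (F i) :=
  MonoidHom.mk' (fun g => col.localActionIn g i c) fun g h => by
    rw [localActionIn_mul, QuotientGroup.mk_mul, ← col.mk_localActionIn_eq hΔ g i c]

theorem continuous_localActionQuotient (hΔ : Δ.IsConnected) (i : I) (c : C) :
    Continuous (col.localActionQuotient hΔ F i c) :=
  continuous_quotient_mk'.comp (col.continuous_localActionIn i c)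

theorem surjective_localActionQuotient {M : CoxeterMatrix I} (hM : M.IsRightAngled)
    (hΔ : Δ.IsBuilding M) (i : I) (c : C) :
    Function.Surjective (col.localActionQuotient hΔ.isConnected F i c) :=
  (QuotientGroup.mk_surjective).comp (col.surjective_localActionIn hM hΔ i c)

end LocalAction

end LegalColouring

theorem mainTheorem6_general {I : Type*} (M : CoxeterMatrix I) (hM : M.IsRightAngled)
    {C : Type*} (Δ : ChamberSystem I C) (hΔ : Δ.IsBuilding M)
    {X : I → Type*} (col : LegalColouring Δ X)
    (F : (i : I) → Subgroup (Equiv.Perm (X i)))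
    (h_compactlyGenerated : IsCompactlyGeneratedGroup (col.universalGroup F))
    (i : I) (h_plus : IsCompactlyGeneratedGroup (plusSubgroup (F i))) :
    IsCompactlyGeneratedGroup (F i) := by
  obtain ⟨c⟩ := hΔ.1
  have h_quotient : IsCompactlyGeneratedGroup (F i ⧸ plusSubgroup (F i)) :=
    h_compactlyGenerated.of_surjective (col.continuous_localActionQuotient hΔ.isConnected i c)
      (col.surjective_localActionQuotient hM hΔ i c)
  exact .of_isOpen_of_quotient (isOpen_plusSubgroup (F i)) h_plus h_quotient

theorem mainTheorem6 {I : Type*} [Finite I] (M : CoxeterMatrix I) (hM : M.IsRightAngled)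
    {C : Type*} (Δ : ChamberSystem I C) (hΔ : Δ.IsBuilding M)
    {X : I → Type*} (col : LegalColouring Δ X)
    (F : (i : I) → Subgroup (Equiv.Perm (X i)))
    (h_closed : IsClosed (col.universalGroup F : Set Δ.Aut))
    (h_locallyCompact : LocallyCompactSpace (col.universalGroup F))
    (h_compactlyGenerated : IsCompactlyGeneratedGroup (col.universalGroup F))
    (h_plus : ∀ i : I, IsCompactlyGeneratedGroup (plusSubgroup (F i))) :
    ∀ i : I, IsCompactlyGeneratedGroup (F i) :=
  fun i => mainTheorem6_general M hM Δ hΔ col F h_compactlyGenerated i (h_plus i)
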